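/- Let $k$ be an algebraically closed field of characteristic zero and let $H$ be a semisimple Hopf algebra over $k$. Recall that a Hopf subalgebra $K\subseteq H$ is normal if $\sum h_1 a S(h_2)\in K$ and $\sum S(h_1)ah_2\in K$ for all $h\in H$, $a\in K$. Suppose that $H$ is the internal tensor product of a finite family $K_{\lambda_1},\dots,K_{\lambda_s}$ of Hopf subalgebras; that is, each $K_{\lambda_i}$ is normal in $H$, the $K_{\lambda_i}$ together generate $H$ as an algebra, and for every $i$ the intersection of $K_{\lambda_i}$ with the subalgebra of $H$ generated by all the $K_{\lambda_j}$ with $j\neq i$ is $k\cdot 1$. Then $H\cong K_{\lambda_1}\otimes\cdots\otimes K_{\lambda_s}$ as Hopf algebras. -/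

import Mathlib

open scoped TensorProduct

noncomputable section

/-! ### Hopf subalgebras -/

section HopfSub

/-- A Hopf subalgebra `K` of a Hopf algebra `H`: a unital subalgebra with
`Δ(K) ⊆ K ⊗ K` (the image of `K ⊗ K` in `H ⊗ H`) and `S(K) ⊆ K`. -/
structure HopfSubalgebra (k : Type*) (H : Type*) [Field k] [Ring H] [HopfAlgebra k H] extends
    Subalgebra k H where
  comul_mem' : ∀ x ∈ carrier, (Coalgebra.comul x : H ⊗[k] H) ∈
    (Algebra.TensorProduct.map toSubalgebra.val toSubalgebra.val).range
  antipode_mem' : ∀ x ∈ carrier, HopfAlgebra.antipode k x ∈ carrier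

namespace HopfSubalgebra

variable {k H : Type*} [Field k] [Ring H] [HopfAlgebra k H]

/-- `K` is normal in `H`: `h₁ a S(h₂) ∈ K` and `S(h₁) a h₂ ∈ K` for all `h ∈ H`, `a ∈ K`. -/
def IsNormal (K : HopfSubalgebra k H) : Prop :=
  ∀ h : H, ∀ a ∈ K.toSubalgebra,
    LinearMap.mul' k H (TensorProduct.map (LinearMap.mulRight k a) (HopfAlgebra.antipode k)
      (Coalgebra.comul h)) ∈ K.toSubalgebra ∧
    LinearMap.mul' k H (TensorProduct.map (HopfAlgebra.antipode k) (LinearMap.mulLeft k a)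
      (Coalgebra.comul h)) ∈ K.toSubalgebra

variable (K : HopfSubalgebra k H)

theorem map_val_injective :
    Function.Injective (Algebra.TensorProduct.map K.val K.val) :=
  TensorProduct.map_injective_of_flat_flat K.val.toLinearMap K.val.toLinearMap
    Subtype.val_injective Subtype.val_injective

theorem map_val_injective₃ :
    Function.Injective
      (Algebra.TensorProduct.map K.val (Algebra.TensorProduct.map K.val K.val)) :=
  TensorProduct.map_injective_of_flat_flat K.val.toLinearMap
    (Algebra.TensorProduct.map K.val K.val).toLinearMap Subtype.val_injective
    K.map_val_injective

/-- The comultiplication of `K`, the restriction of that of `H`. -/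
def comulAlgHom : K.toSubalgebra →ₐ[k] K.toSubalgebra ⊗[k] K.toSubalgebra :=
  (AlgEquiv.ofInjective (Algebra.TensorProduct.map K.val K.val)
      K.map_val_injective).symm.toAlgHom.comp
    (((Bialgebra.comulAlgHom k H).comp K.val).codRestrict _ fun x => K.comul_mem' x x.2)

theorem map_val_comulAlgHom (x : K.toSubalgebra) :
    Algebra.TensorProduct.map K.val K.val (K.comulAlgHom x) = Coalgebra.comul (R := k) (x : H) := by
  have := congrArg Subtype.val ((AlgEquiv.ofInjective (Algebra.TensorProduct.map K.val K.val)
      K.map_val_injective).apply_symm_apply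
    ((((Bialgebra.comulAlgHom k H).comp K.val).codRestrict _ fun x => K.comul_mem' x x.2) x))
  exact this

theorem map_val_comp_comulAlgHom :
    (Algebra.TensorProduct.map K.val K.val).comp K.comulAlgHom =
      (Bialgebra.comulAlgHom k H).comp K.val :=
  AlgHom.ext K.map_val_comulAlgHom

/-- The antipode of `K`, the restriction of that of `H`. -/
def antipodeRestrict : K.toSubalgebra →ₗ[k] K.toSubalgebra :=
  (HopfAlgebra.antipode k (A := H)).restrict (p := K.toSubalgebra.toSubmodule)
    (q := K.toSubalgebra.toSubmodule) K.antipode_mem'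

theorem map_assoc (y : K.toSubalgebra) (w : K.toSubalgebra ⊗[k] K.toSubalgebra) :
    Algebra.TensorProduct.map K.val (Algebra.TensorProduct.map K.val K.val)
      (Algebra.TensorProduct.assoc k k k _ _ _ (w ⊗ₜ[k] y)) =
    Algebra.TensorProduct.assoc k k k _ _ _
      ((Algebra.TensorProduct.map K.val K.val w) ⊗ₜ[k] (y : H)) := by
  induction w with
  | zero => simp
  | tmul a b => simp
  | add a b ha hb => simp only [TensorProduct.add_tmul, map_add, ha, hb]

theorem map_comul_left (z : K.toSubalgebra ⊗[k] K.toSubalgebra) :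
    Algebra.TensorProduct.map K.val (Algebra.TensorProduct.map K.val K.val)
      (Algebra.TensorProduct.assoc k k k _ _ _
        (Algebra.TensorProduct.map K.comulAlgHom (.id k _) z)) =
    Algebra.TensorProduct.assoc k k k _ _ _
      (Algebra.TensorProduct.map (Bialgebra.comulAlgHom k H) (.id k _)
        (Algebra.TensorProduct.map K.val K.val z)) := by
  induction z with
  | zero => simp
  | tmul a b =>
    simp only [Algebra.TensorProduct.map_tmul, AlgHom.id_apply, map_assoc, map_val_comulAlgHom]
    rfl
  | add a b ha hb => simp only [map_add, ha, hb]

theorem map_comul_right (z : K.toSubalgebra ⊗[k] K.toSubalgebra) :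
    Algebra.TensorProduct.map K.val (Algebra.TensorProduct.map K.val K.val)
      (Algebra.TensorProduct.map (.id k _) K.comulAlgHom z) =
    Algebra.TensorProduct.map (.id k _) (Bialgebra.comulAlgHom k H)
      (Algebra.TensorProduct.map K.val K.val z) := by
  induction z with
  | zero => simp
  | tmul a b =>
    simp only [Algebra.TensorProduct.map_tmul, AlgHom.id_apply, map_val_comulAlgHom]
    rfl
  | add a b ha hb => simp only [map_add, ha, hb]

/-- The bialgebra structure of `K`; the counit is the restriction of that of `H`. -/
instance instBialgebra : Bialgebra k K.toSubalgebra :=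
  Bialgebra.ofAlgHom K.comulAlgHom ((Bialgebra.counitAlgHom k H).comp K.val)
    (by
      ext x
      apply K.map_val_injective₃
      refine (K.map_comul_left (K.comulAlgHom x)).trans
        (Eq.trans ?_ (K.map_comul_right (K.comulAlgHom x)).symm)
      rw [map_val_comulAlgHom]
      exact Coalgebra.coassoc_apply (R := k) (x : H))
    (by
      ext x
      apply (TensorProduct.map_injective_of_flat_flat (LinearMap.id (R := k) (M := k))
        K.val.toLinearMap Function.injective_id Subtype.val_injective)
      have key : ∀ z : K.toSubalgebra ⊗[k] K.toSubalgebra,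
          TensorProduct.map (LinearMap.id (R := k) (M := k)) K.val.toLinearMap
            (Algebra.TensorProduct.map ((Bialgebra.counitAlgHom k H).comp K.val) (.id k _) z) =
          (Coalgebra.counit (R := k) (A := H)).rTensor H
            (Algebra.TensorProduct.map K.val K.val z) := by
        intro z
        induction z with
        | zero => simp
        | tmul a b => simp
        | add a b ha hb => simp only [map_add, ha, hb]
      refine (key (K.comulAlgHom x)).trans ?_
      rw [map_val_comulAlgHom, Coalgebra.rTensor_counit_comul]
      simp)
    (by
      ext x
      apply (TensorProduct.map_injective_of_flat_flat K.val.toLinearMap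
        (LinearMap.id (R := k) (M := k)) Subtype.val_injective Function.injective_id)
      have key : ∀ z : K.toSubalgebra ⊗[k] K.toSubalgebra,
          TensorProduct.map K.val.toLinearMap (LinearMap.id (R := k) (M := k))
            (Algebra.TensorProduct.map (.id k _) ((Bialgebra.counitAlgHom k H).comp K.val) z) =
          (Coalgebra.counit (R := k) (A := H)).lTensor H
            (Algebra.TensorProduct.map K.val K.val z) := by
        intro z
        induction z with
        | zero => simp
        | tmul a b => simp
        | add a b ha hb => simp only [map_add, ha, hb]
      refine (key (K.comulAlgHom x)).trans ?_
      rw [map_val_comulAlgHom, Coalgebra.lTensor_counit_comul]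
      simp)

instance instHopfAlgebra : HopfAlgebra k K.toSubalgebra where
  antipode := K.antipodeRestrict
  mul_antipode_rTensor_comul := by
    ext x
    have key : ∀ z : K.toSubalgebra ⊗[k] K.toSubalgebra,
        ((LinearMap.mul' k K.toSubalgebra (K.antipodeRestrict.rTensor _ z) :
          K.toSubalgebra) : H) =
        LinearMap.mul' k H ((HopfAlgebra.antipode k).rTensor H
          (Algebra.TensorProduct.map K.val K.val z)) := by
      intro z
      induction z with
      | zero => simp
      | tmul a b => simp; rfl
      | add a b ha hb => simp only [map_add, AddMemClass.coe_add, ha, hb]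
    refine (key (K.comulAlgHom x)).trans ?_
    rw [map_val_comulAlgHom, HopfAlgebra.mul_antipode_rTensor_comul_apply]
    rfl
  mul_antipode_lTensor_comul := by
    ext x
    have key : ∀ z : K.toSubalgebra ⊗[k] K.toSubalgebra,
        ((LinearMap.mul' k K.toSubalgebra (K.antipodeRestrict.lTensor _ z) :
          K.toSubalgebra) : H) =
        LinearMap.mul' k H ((HopfAlgebra.antipode k).lTensor H
          (Algebra.TensorProduct.map K.val K.val z)) := by
      intro z
      induction z with
      | zero => simp
      | tmul a b => simp; rfl
      | add a b ha hb => simp only [map_add, AddMemClass.coe_add, ha, hb]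
    refine (key (K.comulAlgHom x)).trans ?_
    rw [map_val_comulAlgHom, HopfAlgebra.mul_antipode_lTensor_comul_apply]
    rfl

end HopfSubalgebra

/-- `H` is the internal tensor product of the family `K` of Hopf subalgebras: every `K i` is normal
in `H`, the `K i` generate `H`, and each `K i` meets the subalgebra generated by the
others in the scalars `k = k · 1`. -/
structure IsInternalTensorProduct {k H ι : Type*} [Field k] [Ring H] [HopfAlgebra k H]
    (K : ι → HopfSubalgebra k H) : Prop where
  normal : ∀ i, (K i).IsNormal
  generate : ⨆ i, (K i).toSubalgebra = ⊤
  inf_eq : ∀ i, (K i).toSubalgebra ⊓ ⨆ j, ⨆ _ : j ≠ i, (K j).toSubalgebra = ⊥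

end HopfSub

/-! ### The tensor product of a finite family of Hopf algebras -/

namespace PiTensorProduct

section Lift

variable {k ι : Type*} [Field k] {A : ι → Type*} [∀ i, Ring (A i)]
  [∀ i, Algebra k (A i)] {B : Type*} [Ring B] [Algebra k B]

theorem pairwise_commute {f : ∀ i, A i →ₐ[k] B}
    (hf : ∀ i j, i ≠ j → ∀ x y, Commute (f i x) (f j y)) (s : Set ι) (x : ∀ i, A i) :
    s.Pairwise (Function.onFun Commute fun i => f i (x i)) :=
  fun i _ j _ hij => hf i j hij _ _

variable [Fintype ι]

open scoped Classical in
theorem noncommProd_update (f : ∀ i, A i →ₐ[k] B)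
    (hf : ∀ i j, i ≠ j → ∀ x y, Commute (f i x) (f j y)) (m : ∀ i, A i) (i : ι) (x : A i) :
    Finset.univ.noncommProd (fun j => f j (Function.update m i x j))
        (pairwise_commute hf _ _) =
      f i x * (Finset.univ.erase i).noncommProd (fun j => f j (m j))
        (pairwise_commute hf _ _) := by
  rw [← Finset.mul_noncommProd_erase _ (Finset.mem_univ i)]
  congr 1
  · simp
  · refine Finset.noncommProd_congr rfl (fun j hj => ?_) _
    rw [Function.update_of_ne (Finset.ne_of_mem_erase hj)]

/-- Algebra maps `f i : A i → B` with pairwise commuting images induce the algebra map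
`⨂ A i → B`, `⨂ a i ↦ ∏ f i (a i)`. -/
def liftCommute (f : ∀ i, A i →ₐ[k] B) (hf : ∀ i j, i ≠ j → ∀ x y, Commute (f i x) (f j y)) :
    (⨂[k] i, A i) →ₐ[k] B :=
  liftAlgHom
    { toFun := fun x => Finset.univ.noncommProd (fun i => f i (x i))
        (pairwise_commute hf _ x)
      map_update_add' := by
        intro h m i x y
        obtain rfl := Subsingleton.elim h (Classical.decEq ι)
        simp only [noncommProd_update f hf, map_add, add_mul]
      map_update_smul' := by
        intro h m i c x
        obtain rfl := Subsingleton.elim h (Classical.decEq ι)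
        simp only [noncommProd_update f hf, map_smul, smul_mul_assoc] }
    ((Finset.noncommProd_eq_pow_card _ _ (pairwise_commute hf _ 1) 1 fun i _ => by simp).trans (one_pow _))
    (fun x y => by
      refine Eq.trans ?_ (Finset.noncommProd_mul_distrib (fun i => f i (x i))
        (fun i => f i (y i)) (pairwise_commute hf _ x) (pairwise_commute hf _ y)
        (fun i _ j _ hij => hf i j hij _ _))
      exact Finset.noncommProd_congr rfl (fun i _ => by simp) (pairwise_commute hf _ (x * y)))

theorem liftCommute_tprod (f : ∀ i, A i →ₐ[k] B)
    (hf : ∀ i j, i ≠ j → ∀ x y, Commute (f i x) (f j y)) (x : ∀ i, A i) :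
    liftCommute f hf (tprod k x) = Finset.univ.noncommProd (fun i => f i (x i))
        (pairwise_commute hf _ x) := by
  exact lift.tprod (R := k) x

open scoped Classical in
theorem liftCommute_single (f : ∀ i, A i →ₐ[k] B)
    (hf : ∀ i j, i ≠ j → ∀ x y, Commute (f i x) (f j y)) (i : ι) (a : A i) :
    liftCommute f hf (singleAlgHom (R := k) i a) = f i a := by
  refine (liftCommute_tprod f hf _).trans ((noncommProd_update f hf 1 i a).trans ?_)
  rw [Finset.noncommProd_eq_pow_card _ _ _ 1 (fun i _ => by simp), one_pow, mul_one]

end Lift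

section Hopf

variable {k ι : Type*} [Field k] {A : ι → Type*} [∀ i, Ring (A i)]

open scoped Classical in
theorem commute_single [∀ i, Algebra k (A i)] (i j : ι) (hij : i ≠ j) (x : A i) (y : A j) :
    Commute (singleAlgHom (R := k) (A := A) i x) (singleAlgHom j y) :=
  Commute.tprod (Pi.mulSingle_commute hij x y)

open scoped Classical in
theorem commute_map_single [∀ i, Algebra k (A i)] (i j : ι) (hij : i ≠ j)
    (x : A i ⊗[k] A i) (y : A j ⊗[k] A j) :
    Commute (Algebra.TensorProduct.map (singleAlgHom (R := k) (A := A) i) (singleAlgHom i) x)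
      (Algebra.TensorProduct.map (singleAlgHom (R := k) (A := A) j) (singleAlgHom j) y) := by
  induction x with
  | zero => simp
  | add a b ha hb => rw [map_add]; exact ha.add_left hb
  | tmul a b =>
    induction y with
    | zero => simp
    | add c d hc hd => rw [map_add]; exact hc.add_right hd
    | tmul c d =>
      simp only [Algebra.TensorProduct.map_tmul, Commute, SemiconjBy,
        Algebra.TensorProduct.tmul_mul_tmul, (commute_single i j hij a c).eq,
        (commute_single i j hij b d).eq]

open scoped Classical in
/-- The comultiplication of `⨂ A i`: the algebra map which on `A i` is `Δ` of `A i` followed by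
`A i ⊗ A i → (⨂ A i) ⊗ (⨂ A i)`, that is, `⨂ a i ↦ ∑ (⨂ (a i)₁) ⊗ (⨂ (a i)₂)`. -/
def comulAlgHom [Fintype ι] (k : Type*) [Field k] (A : ι → Type*) [∀ i, Ring (A i)] [∀ i, Bialgebra k (A i)] :
    (⨂[k] i, A i) →ₐ[k] (⨂[k] i, A i) ⊗[k] (⨂[k] i, A i) :=
  liftCommute (fun i => (Algebra.TensorProduct.map (singleAlgHom i) (singleAlgHom i)).comp
      (Bialgebra.comulAlgHom k (A i)))
    (fun i j hij _ _ => commute_map_single i j hij _ _)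

/-- The counit of `⨂ A i`: `⨂ a i ↦ ∏ ε (a i)`. -/
def counitAlgHom [Fintype ι] (k : Type*) [Field k] (A : ι → Type*) [∀ i, Ring (A i)] [∀ i, Bialgebra k (A i)] :
    (⨂[k] i, A i) →ₐ[k] k :=
  liftCommute (fun i => Bialgebra.counitAlgHom k (A i)) (fun _ _ _ _ _ => Commute.all _ _)

section
variable [Fintype ι] [∀ i, Bialgebra k (A i)]

theorem counitAlgHom_tprod (x : ∀ i, A i) :
    counitAlgHom k A (tprod k x) = ∏ i, Coalgebra.counit (R := k) (x i) := by
  simp [counitAlgHom, liftCommute_tprod, Finset.noncommProd_eq_prod]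

open scoped Classical in
theorem counitAlgHom_single (i : ι) (a : A i) :
    counitAlgHom k A (singleAlgHom i a) = Coalgebra.counit (R := k) a :=
  liftCommute_single _ _ i a

open scoped Classical in
theorem comulAlgHom_single (i : ι) (a : A i) :
    comulAlgHom k A (singleAlgHom i a) =
      Algebra.TensorProduct.map (singleAlgHom i) (singleAlgHom i)
        (Coalgebra.comul (R := k) a) :=
  liftCommute_single _ _ i a

open scoped Classical in
/-- The bialgebra structure of `⨂ A i`. -/
instance instBialgebra : Bialgebra k (⨂[k] i, A i) :=
  Bialgebra.ofAlgHom (comulAlgHom k A) (counitAlgHom k A)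
    (by
      refine algHom_ext fun i => AlgHom.ext fun a => ?_
      have h1 : ∀ (y : A i) (w : A i ⊗[k] A i),
          Algebra.TensorProduct.assoc k k k _ _ _
            ((Algebra.TensorProduct.map (singleAlgHom (R := k) (A := A) i) (singleAlgHom i) w)
              ⊗ₜ[k] singleAlgHom i y) =
          Algebra.TensorProduct.map (singleAlgHom i)
            (Algebra.TensorProduct.map (singleAlgHom i) (singleAlgHom i))
            (Algebra.TensorProduct.assoc k k k _ _ _ (w ⊗ₜ[k] y)) := by
        intro y w
        induction w with
        | zero => simp
        | tmul a b => simp only [Algebra.TensorProduct.map_tmul, Algebra.TensorProduct.assoc_tmul]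
        | add a b ha hb => simp only [TensorProduct.add_tmul, map_add, ha, hb]
      have h2 : ∀ z : A i ⊗[k] A i,
          Algebra.TensorProduct.assoc k k k _ _ _
            (Algebra.TensorProduct.map (comulAlgHom k A) (.id k _)
              (Algebra.TensorProduct.map (singleAlgHom i) (singleAlgHom i) z)) =
          Algebra.TensorProduct.map (singleAlgHom i)
            (Algebra.TensorProduct.map (singleAlgHom i) (singleAlgHom i))
            (Algebra.TensorProduct.assoc k k k _ _ _
              (Algebra.TensorProduct.map (Bialgebra.comulAlgHom k (A i)) (.id k _) z)) := by
        intro z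
        induction z with
        | zero => simp
        | tmul a b =>
          simp only [Algebra.TensorProduct.map_tmul, AlgHom.id_apply, comulAlgHom_single, h1]
          rfl
        | add a b ha hb => simp only [map_add, ha, hb]
      have h3 : ∀ z : A i ⊗[k] A i,
          Algebra.TensorProduct.map (.id k (⨂[k] i, A i)) (comulAlgHom k A)
              (Algebra.TensorProduct.map (singleAlgHom i) (singleAlgHom i) z) =
          Algebra.TensorProduct.map (singleAlgHom i)
            (Algebra.TensorProduct.map (singleAlgHom i) (singleAlgHom i))
              (Algebra.TensorProduct.map (.id k _) (Bialgebra.comulAlgHom k (A i)) z) := by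
        intro z
        induction z with
        | zero => simp
        | tmul a b =>
          simp only [Algebra.TensorProduct.map_tmul, AlgHom.id_apply, comulAlgHom_single]
          rfl
        | add a b ha hb => simp only [map_add, ha, hb]
      change Algebra.TensorProduct.assoc k k k _ _ _
            (Algebra.TensorProduct.map (comulAlgHom k A) (.id k _)
              (comulAlgHom k A (singleAlgHom i a))) =
          Algebra.TensorProduct.map (.id k (⨂[k] i, A i)) (comulAlgHom k A)
            (comulAlgHom k A (singleAlgHom i a))
      rw [comulAlgHom_single, h2, h3]
      exact congrArg _ (Coalgebra.coassoc_apply (R := k) a))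
    (by
      refine algHom_ext fun i => AlgHom.ext fun a => ?_
      have h : ∀ z : A i ⊗[k] A i,
          Algebra.TensorProduct.map (counitAlgHom k A) (.id k _)
              (Algebra.TensorProduct.map (singleAlgHom i) (singleAlgHom i) z) =
          Algebra.TensorProduct.map (.id k k) (singleAlgHom i)
              ((Coalgebra.counit (R := k)).rTensor _ z) := by
        intro z
        induction z with
        | zero => simp
        | tmul a b =>
          simp only [Algebra.TensorProduct.map_tmul, AlgHom.id_apply, counitAlgHom_single,
            LinearMap.rTensor_tmul]
        | add a b ha hb => simp only [map_add, ha, hb]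
      change Algebra.TensorProduct.map (counitAlgHom k A) (.id k (⨂[k] i, A i))
            (comulAlgHom k A (singleAlgHom i a)) = _
      rw [comulAlgHom_single, h, Coalgebra.rTensor_counit_comul]
      rfl)
    (by
      refine algHom_ext fun i => AlgHom.ext fun a => ?_
      have h : ∀ z : A i ⊗[k] A i,
          Algebra.TensorProduct.map (.id k (⨂[k] i, A i)) (counitAlgHom k A)
              (Algebra.TensorProduct.map (singleAlgHom i) (singleAlgHom i) z) =
          Algebra.TensorProduct.map (singleAlgHom i) (.id k k)
              ((Coalgebra.counit (R := k)).lTensor _ z) := by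
        intro z
        induction z with
        | zero => simp
        | tmul a b =>
          simp only [Algebra.TensorProduct.map_tmul, AlgHom.id_apply, counitAlgHom_single,
            LinearMap.lTensor_tmul]
        | add a b ha hb => simp only [map_add, ha, hb]
      change Algebra.TensorProduct.map (.id k (⨂[k] i, A i)) (counitAlgHom k A)
            (comulAlgHom k A (singleAlgHom i a)) = _
      rw [comulAlgHom_single, h, Coalgebra.lTensor_counit_comul]
      rfl)

end

variable [∀ i, HopfAlgebra k (A i)]

/-- The antipode of `⨂ A i`: `⨂ a i ↦ ⨂ S (a i)`. -/
def antipodeMap (k : Type*) [Field k] (A : ι → Type*) [∀ i, Ring (A i)]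
    [∀ i, HopfAlgebra k (A i)] : (⨂[k] i, A i) →ₗ[k] (⨂[k] i, A i) :=
  map fun i => HopfAlgebra.antipode k (A := A i)

theorem antipodeMap_one : antipodeMap k A 1 = 1 := by
  rw [one_def, antipodeMap, map_tprod]
  congr 1
  ext i
  exact HopfAlgebra.antipode_one

theorem antipodeMap_mul (x y : ⨂[k] i, A i) :
    antipodeMap k A (x * y) = antipodeMap k A y * antipodeMap k A x := by
  induction x using PiTensorProduct.induction_on with
  | add a b ha hb => simp only [add_mul, mul_add, map_add, ha, hb]
  | smul_tprod r a =>
    induction y using PiTensorProduct.induction_on with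
    | add c d hc hd => simp only [add_mul, mul_add, map_add, hc, hd]
    | smul_tprod s b =>
      simp only [smul_mul_assoc, mul_smul_comm, map_smul, tprod_mul_tprod, antipodeMap, map_tprod,
        smul_comm r s]
      congr 3
      ext i
      exact HopfAlgebra.antipode_mul_antidistrib (a i) (b i)

open scoped Classical in
theorem antipodeMap_single (i : ι) (a : A i) :
    antipodeMap k A (singleAlgHom i a) = singleAlgHom i (HopfAlgebra.antipode k a) := by
  simp only [antipodeMap, singleAlgHom_apply, map_tprod, MonoidHom.mulSingle_apply]
  congr 1
  ext j
  exact Pi.apply_mulSingle (fun i => HopfAlgebra.antipode k (A := A i)) (fun i => by simp) i a j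

open scoped Classical in
/-- A subset of `⨂ A i` containing the images of the `A i`, closed under the operations, is
everything. -/
theorem single_induction [Fintype ι] {p : (⨂[k] i, A i) → Prop} (hs : ∀ i a, p (singleAlgHom i a))
    (h1 : p 1) (hadd : ∀ x y, p x → p y → p (x + y)) (hsmul : ∀ (c : k) x, p x → p (c • x))
    (hmul : ∀ x y, p x → p y → p (x * y)) (x : ⨂[k] i, A i) : p x := by
  induction x using PiTensorProduct.induction_on with
  | add a b ha hb => exact hadd _ _ ha hb
  | smul_tprod r a =>
    refine hsmul _ _ ?_
    have : tprod k a = Finset.univ.noncommProd (fun i => singleAlgHom (R := k) i (a i))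
        (pairwise_commute commute_single _ a) := by
      conv_lhs => rw [← Finset.noncommProd_mulSingle a]
      exact tprod_noncommProd _ _ _
    rw [this]
    exact Finset.noncommProd_induction _ _ _ p hmul h1 fun i _ => hs i _

open scoped Classical in
/-- The Hopf algebra structure of `⨂ A i`. -/
instance instHopfAlgebra [Fintype ι] : HopfAlgebra k (⨂[k] i, A i) where
  antipode := antipodeMap k A
  mul_antipode_rTensor_comul := by
    refine LinearMap.ext fun x => ?_
    change LinearMap.mul' k _ ((antipodeMap k A).rTensor _ (comulAlgHom k A x)) =
      algebraMap k _ (counitAlgHom k A x)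
    induction x using single_induction with
    | hs i a =>
      have h : ∀ z : A i ⊗[k] A i,
          LinearMap.mul' k _ ((antipodeMap k A).rTensor _
            (Algebra.TensorProduct.map (singleAlgHom i) (singleAlgHom i) z)) =
          singleAlgHom i (LinearMap.mul' k _ ((HopfAlgebra.antipode k).rTensor _ z)) := by
        intro z
        induction z with
        | zero => simp only [map_zero]
        | tmul a b =>
          simp only [Algebra.TensorProduct.map_tmul, LinearMap.rTensor_tmul, antipodeMap_single,
            LinearMap.mul'_apply, map_mul]
        | add a b ha hb => simp only [map_add, ha, hb]
      rw [comulAlgHom_single, h, HopfAlgebra.mul_antipode_rTensor_comul_apply,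
        counitAlgHom_single, AlgHom.commutes]
    | h1 =>
      rw [map_one (comulAlgHom k A), map_one (counitAlgHom k A), map_one (algebraMap k _),
        Algebra.TensorProduct.one_def, LinearMap.rTensor_tmul, LinearMap.mul'_apply, mul_one,
        antipodeMap_one]
    | hadd x y hx hy => simp only [map_add, hx, hy]
    | hsmul c x hx =>
      simp only [map_smul, hx, smul_eq_mul, map_mul]
      rw [Algebra.smul_def]
    | hmul x y hx hy =>
      have h : ∀ X Y : (⨂[k] i, A i) ⊗[k] (⨂[k] i, A i), ∀ r : k,
          LinearMap.mul' k _ ((antipodeMap k A).rTensor _ X) = algebraMap k _ r →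
          LinearMap.mul' k _ ((antipodeMap k A).rTensor _ (X * Y)) =
            algebraMap k _ r * LinearMap.mul' k _ ((antipodeMap k A).rTensor _ Y) := by
        intro X Y r hX
        induction Y with
        | zero => simp
        | add a b ha hb => simp only [mul_add, map_add, ha, hb]
        | tmul b c =>
          have h' : ∀ X : (⨂[k] i, A i) ⊗[k] (⨂[k] i, A i),
              LinearMap.mul' k _ ((antipodeMap k A).rTensor _ (X * b ⊗ₜ[k] c)) =
              antipodeMap k A b * LinearMap.mul' k _ ((antipodeMap k A).rTensor _ X) * c := by
            intro X
            induction X with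
            | zero => simp
            | add u v hu hv => simp only [mul_add, add_mul, map_add, hu, hv]
            | tmul u v =>
              simp only [Algebra.TensorProduct.tmul_mul_tmul, LinearMap.rTensor_tmul,
                LinearMap.mul'_apply, antipodeMap_mul, mul_assoc]
          rw [h', hX, ← Algebra.commutes, mul_assoc, LinearMap.rTensor_tmul, LinearMap.mul'_apply]
      rw [map_mul, h _ _ _ hx, hy, map_mul, map_mul]
  mul_antipode_lTensor_comul := by
    refine LinearMap.ext fun x => ?_
    change LinearMap.mul' k _ ((antipodeMap k A).lTensor _ (comulAlgHom k A x)) =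
      algebraMap k _ (counitAlgHom k A x)
    induction x using single_induction with
    | hs i a =>
      have h : ∀ z : A i ⊗[k] A i,
          LinearMap.mul' k _ ((antipodeMap k A).lTensor _
            (Algebra.TensorProduct.map (singleAlgHom i) (singleAlgHom i) z)) =
          singleAlgHom i (LinearMap.mul' k _ ((HopfAlgebra.antipode k).lTensor _ z)) := by
        intro z
        induction z with
        | zero => simp only [map_zero]
        | tmul a b =>
          simp only [Algebra.TensorProduct.map_tmul, LinearMap.lTensor_tmul, antipodeMap_single,
            LinearMap.mul'_apply, map_mul]
        | add a b ha hb => simp only [map_add, ha, hb]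
      rw [comulAlgHom_single, h, HopfAlgebra.mul_antipode_lTensor_comul_apply,
        counitAlgHom_single, AlgHom.commutes]
    | h1 =>
      rw [map_one (comulAlgHom k A), map_one (counitAlgHom k A), map_one (algebraMap k _),
        Algebra.TensorProduct.one_def, LinearMap.lTensor_tmul, LinearMap.mul'_apply, one_mul,
        antipodeMap_one]
    | hadd x y hx hy => simp only [map_add, hx, hy]
    | hsmul c x hx =>
      simp only [map_smul, hx, smul_eq_mul, map_mul]
      rw [Algebra.smul_def]
    | hmul x y hx hy =>
      have h : ∀ X Y : (⨂[k] i, A i) ⊗[k] (⨂[k] i, A i), ∀ r : k,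
          LinearMap.mul' k _ ((antipodeMap k A).lTensor _ Y) = algebraMap k _ r →
          LinearMap.mul' k _ ((antipodeMap k A).lTensor _ (X * Y)) =
            LinearMap.mul' k _ ((antipodeMap k A).lTensor _ X) * algebraMap k _ r := by
        intro X Y r hY
        induction X with
        | zero => simp
        | add a b ha hb => simp only [add_mul, map_add, ha, hb]
        | tmul b c =>
          have h' : ∀ Y : (⨂[k] i, A i) ⊗[k] (⨂[k] i, A i),
              LinearMap.mul' k _ ((antipodeMap k A).lTensor _ (b ⊗ₜ[k] c * Y)) =
              b * LinearMap.mul' k _ ((antipodeMap k A).lTensor _ Y) * antipodeMap k A c := by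
            intro Y
            induction Y with
            | zero => simp
            | add u v hu hv => simp only [mul_add, add_mul, map_add, hu, hv]
            | tmul u v =>
              simp only [Algebra.TensorProduct.tmul_mul_tmul, LinearMap.lTensor_tmul,
                LinearMap.mul'_apply, antipodeMap_mul, mul_assoc]
          rw [h', hY, mul_assoc, Algebra.commutes, ← mul_assoc, LinearMap.lTensor_tmul,
            LinearMap.mul'_apply]
      rw [map_mul, h _ _ _ hy, hx, map_mul, map_mul]

end Hopf

end PiTensorProduct

end

/-! Elements of different factors commute (`HopfSubalgebra.IsNormal.commute`): the Hopf commutator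
`∑ a₁ b₁ S(a₂) S(b₂)` lies in both factors by normality, hence is a scalar, which the counit
identifies as `ε(a)ε(b)`; uniqueness of convolution inverses then gives `ab = ba`. Multiplication is
therefore a surjective bialgebra map `m : ⨂ K i → H`, and only its injectivity remains.

Trivial intersections do not give injectivity directly; they show that coinvariants, the `w` with `∑
m(w₁) ⊗ w₂ = 1 ⊗ w`, are scalars (`PiTensorProduct.eq_counit_smul_one_of_coinvariant`). Integrals
bridge the gap. Semisimplicity yields a nonzero left integral `Λ`, and the bijection `f ↦ ∑ f(Λ₁)
Λ₂` from `H*` to `H` yields a nonzero functional `t` with `∑ t(h₁) h₂ = t(h) 1`. For `l = t ∘ m`,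
every `∑ l(z₁) z₂` is coinvariant, hence equal to `l(z) 1`, so `l` is again an integral functional.
Such functionals are nondegenerate (`HopfAlgebra.eq_zero_of_integral_functional`), while `m(x) = 0`
forces `l(xb) = 0` for all `b`; so `x = 0`. -/

noncomputable section

open Coalgebra WithConv

/-! ### Contractions and scalar-valued elements of the convolution algebra -/

section Convolution

variable {k C B : Type*} [Field k]

section Coalgebra

variable [AddCommGroup C] [Module k C] [Coalgebra k C]

namespace Coalgebra

/-- The left contraction `z ↦ ∑ f(z₁) z₂` of a coalgebra by a functional `f`. -/
def contract (f : C →ₗ[k] k) : C →ₗ[k] C :=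
  (TensorProduct.lid k C).toLinearMap ∘ₗ f.rTensor C ∘ₗ comul

theorem Repr.contract_eq {ι : Type*} {z : C} (R : Repr k z ι) (f : C →ₗ[k] k) :
    contract f z = ∑ i ∈ R.index, f (R.left i) • R.right i := by
  simp [contract, ← R.eq]

/-- With basis vectors as right legs, an identity in a tensor product can be tested one left leg at
a time, by linear independence. -/
theorem exists_repr_right_basis {κ : Type*} (b : Module.Basis κ k C) (z : C) :
    ∃ R : Repr k z κ, R.right = b := by
  obtain ⟨c, hc⟩ := TensorProduct.eq_repr_basis_right b (comul (R := k) z)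
  exact ⟨⟨c.support, c, b, hc⟩, rfl⟩

theorem exists_repr_left_basis {κ : Type*} (b : Module.Basis κ k C) (z : C) :
    ∃ R : Repr k z κ, R.left = b := by
  obtain ⟨c, hc⟩ := TensorProduct.eq_repr_basis_left b (comul (R := k) z)
  exact ⟨⟨c.support, b, c, hc⟩, rfl⟩

theorem Repr.sum_smul_counit {ι : Type*} {z : C} (R : Repr k z ι) :
    ∑ i ∈ R.index, counit (R := k) (R.right i) • R.left i = z := by
  have := congrArg (_root_.TensorProduct.rid k C) (sum_tmul_counit_eq R)
  simpa only [map_sum, _root_.TensorProduct.rid_tmul, one_smul] using this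

theorem counit_contract (f : C →ₗ[k] k) (z : C) : counit (R := k) (contract f z) = f z := by
  conv_rhs => rw [← (ℛ k z).sum_smul_counit]
  simp [(ℛ k z).contract_eq, mul_comm]

end Coalgebra

namespace LinearMap

variable [Ring B] [Algebra k B]

variable (B) in
/-- A functional on `C`, seen as a scalar valued element of the convolution algebra. -/
def convScalar (f : C →ₗ[k] k) : WithConv (C →ₗ[k] B) := toConv (Algebra.linearMap k B ∘ₗ f)

omit [Coalgebra k C] in
@[simp]
theorem convScalar_apply (f : C →ₗ[k] k) (z : C) : convScalar B f z = algebraMap k B (f z) := rfl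

/-- This turns iterated contractions into associativity of convolution, replacing manipulations of
Sweedler indices. -/
theorem convScalar_mul_apply (f : C →ₗ[k] k) (g : WithConv (C →ₗ[k] B)) (z : C) :
    (convScalar B f * g) z = g (contract f z) := by
  rw [(ℛ k z).convMul_apply, (ℛ k z).contract_eq, map_sum]
  simp [Algebra.smul_def]

theorem mul_convScalar_apply {ι : Type*} {z : C} (R : Repr k z ι) (f : C →ₗ[k] k)
    (g : WithConv (C →ₗ[k] B)) :
    (g * convScalar B f) z = g (∑ i ∈ R.index, f (R.right i) • R.left i) := by
  rw [R.convMul_apply, map_sum]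
  simp [Algebra.smul_def, Algebra.commutes]

theorem convScalar_mul (f g : WithConv (C →ₗ[k] k)) :
    convScalar B (f * g).ofConv = convScalar B f.ofConv * convScalar B g.ofConv := by
  ext z
  simp [(ℛ k z).convMul_apply]

end LinearMap

end Coalgebra

end Convolution

/-! ### Integrals in a Hopf algebra and integral functionals on it -/

section Integral

open LinearMap

variable {k H : Type*} [Field k] [Ring H] [HopfAlgebra k H]

namespace HopfAlgebra

/-- A semisimple Hopf algebra has a nonzero left integral. -/
theorem exists_left_integral [IsSemisimpleRing H] :
    ∃ Λ : H, Λ ≠ 0 ∧ ∀ h : H, h * Λ = counit (R := k) h • Λ := by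
  -- `Λ` is the component of `1` in a left ideal complementary to the augmentation ideal. Then `hΛ -
  -- ε(h)Λ` lies in both ideals, so it vanishes.
  obtain ⟨C, hC⟩ := exists_isCompl (RingHom.ker (Bialgebra.counitAlgHom k H) : Ideal H)
  obtain ⟨e, he, Λ, hΛ, h1⟩ := Submodule.mem_sup.1
    (hC.sup_eq_top ▸ Submodule.mem_top : (1 : H) ∈ RingHom.ker (Bialgebra.counitAlgHom k H) ⊔ C)
  have hε : counit (R := k) Λ = 1 := by
    have := congrArg (Bialgebra.counitAlgHom k H) h1
    rw [map_add, RingHom.mem_ker.1 he, zero_add, map_one] at this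
    exact this
  refine ⟨Λ, fun h => by simp [h] at hε, fun h => ?_⟩
  rw [← sub_eq_zero]
  refine (Submodule.disjoint_def.1 hC.disjoint) _ ?_ ?_
  · simp [RingHom.mem_ker, hε]
  · refine C.sub_mem (C.smul_mem h hΛ) ?_
    rw [Algebra.smul_def]
    exact C.smul_mem _ hΛ

-- One has `1 ⊗ h = ∑ (S(h₁) ⊗ 1) Δ(h₂)`, and `Δ(h₂) Δ(Λ) = Δ(h₂Λ) = ε(h₂) Δ(Λ)`.
open Algebra.TensorProduct in
theorem one_tmul_mul_comul_left_integral {Λ : H}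
    (hΛ : ∀ h : H, h * Λ = counit (R := k) h • Λ) (h : H) :
    ((1 : H) ⊗ₜ[k] h) * comul Λ = (antipode k h ⊗ₜ[k] (1 : H)) * comul Λ := by
  have e1 : (toConv (comul (R := k) (A := H)) : WithConv (H →ₗ[k] H ⊗[k] H)) =
      toConv ((includeLeft : H →ₐ[k] H ⊗[k] H).toLinearMap) *
        toConv (includeRight : H →ₐ[k] H ⊗[k] H).toLinearMap := by
    ext z
    rw [(ℛ k z).convMul_apply]
    simp [(ℛ k z).eq]
  have e2 : toConv ((includeLeft : H →ₐ[k] H ⊗[k] H).toLinearMap ∘ₗ antipode k) *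
      toConv ((includeLeft : H →ₐ[k] H ⊗[k] H).toLinearMap) = 1 := by
    have := algHom_comp_convMul_distrib (includeLeft : H →ₐ[k] H ⊗[k] H)
      (toConv (antipode k (A := H))) (toConv LinearMap.id)
    rw [antipode_mul_id] at this
    apply WithConv.ext
    refine this.symm.trans ?_
    ext z
    simp
  have e3 := congrArg (toConv ((includeLeft : H →ₐ[k] H ⊗[k] H).toLinearMap ∘ₗ antipode k) * ·) e1
  simp only [← mul_assoc, e2, one_mul] at e3
  have e4 := congrArg (fun f : WithConv (H →ₗ[k] H ⊗[k] H) => f h) e3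
  simp only [(ℛ k h).convMul_apply] at e4
  have e5 : (includeRight : H →ₐ[k] H ⊗[k] H) h = 1 ⊗ₜ h := rfl
  change _ = (includeRight : H →ₐ[k] H ⊗[k] H) h at e4
  rw [← e5, ← e4, Finset.sum_mul]
  conv_rhs => rw [← (ℛ k h).sum_smul_counit]
  simp only [map_sum, TensorProduct.sum_tmul, Finset.sum_mul]
  refine Finset.sum_congr rfl fun i _ => ?_
  simp only [mul_assoc]
  change (antipode k _ ⊗ₜ 1) * (comul _ * comul Λ) = _
  rw [← Bialgebra.comul_mul, hΛ, map_smul, map_smul, mul_smul_comm, ← TensorProduct.smul_tmul',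
    smul_mul_assoc]

/-- Apply `f ⊗ id` to the previous identity. Consequently the contractions of `Λ` form a left ideal.
-/
theorem mul_contract_left_integral {Λ : H}
    (hΛ : ∀ h : H, h * Λ = counit (R := k) h • Λ) (h : H) (f : H →ₗ[k] k) :
    h * contract f Λ = contract (f ∘ₗ LinearMap.mulLeft k (antipode k h)) Λ := by
  have := congrArg (fun z => TensorProduct.lid k H (f.rTensor H z))
    (one_tmul_mul_comul_left_integral hΛ h)
  simp only [← (ℛ k Λ).eq, Finset.mul_sum, map_sum, Algebra.TensorProduct.tmul_mul_tmul,
    one_mul, LinearMap.rTensor_tmul, TensorProduct.lid_tmul] at this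
  simpa [(ℛ k Λ).contract_eq, Finset.mul_sum] using this

/-- The elements `∑ f(Λ₁) Λ₂` exhaust `H` for a nonzero left integral `Λ`. -/
theorem exists_contract_left_integral_eq {Λ : H} (h0 : Λ ≠ 0)
    (hΛ : ∀ h : H, h * Λ = counit (R := k) h • Λ) (h : H) :
    ∃ f : H →ₗ[k] k, contract f Λ = h := by
  let V : Submodule k H :=
    { carrier := {x | ∃ f : H →ₗ[k] k, contract f Λ = x}
      zero_mem' := ⟨0, by simp [contract]⟩
      add_mem' := by
        rintro _ _ ⟨f, rfl⟩ ⟨g, rfl⟩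
        exact ⟨f + g, by simp [contract, LinearMap.rTensor_add]⟩
      smul_mem' := by
        rintro c _ ⟨f, rfl⟩
        exact ⟨c • f, by simp [contract, LinearMap.rTensor_smul]⟩ }
  have hV : ∀ h, ∀ x ∈ V, h * x ∈ V := by
    rintro h _ ⟨f, rfl⟩
    exact ⟨_, (mul_contract_left_integral hΛ h f).symm⟩
  suffices (1 : H) ∈ V from mul_one h ▸ hV h 1 this
  obtain ⟨f, hf⟩ := Module.Projective.exists_dual_eq_one k h0
  let b := Module.Basis.ofVectorSpace k H
  obtain ⟨R, hR⟩ := exists_repr_left_basis b Λ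
  -- Since `S * id` is the convolution unit, this reads `f(Λ) = 1`. Bracketed as written, it
  -- expresses `1` as a left combination of the right legs of `Δ(Λ)`, each a contraction of `Λ` by a
  -- coordinate functional.
  have key : ((convScalar H f * toConv (antipode k (A := H))) * toConv LinearMap.id :
      WithConv (H →ₗ[k] H)) Λ = 1 := by
    rw [mul_assoc, antipode_mul_id, mul_one]
    simp [hf]
  rw [R.convMul_apply] at key
  rw [← key]
  refine V.sum_mem fun i hi => hV _ _ ⟨b.coord i, ?_⟩
  rw [R.contract_eq, hR, Finset.sum_eq_single i]
  · simp
  · intro j _ hj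
    simp [hj]
  · exact fun h => absurd hi h

/-- A Hopf algebra with a nonzero left integral has a nonzero right integral functional. -/
theorem exists_integral_functional {Λ : H} (h0 : Λ ≠ 0)
    (hΛ : ∀ h : H, h * Λ = counit (R := k) h • Λ) :
    ∃ t : H →ₗ[k] k, t ≠ 0 ∧ ∀ h, contract t h = t h • 1 := by
  let φ : Module.Dual k H →ₗ[k] H :=
    { toFun := fun f => contract f Λ
      map_add' := fun f g => by simp [contract, LinearMap.rTensor_add]
      map_smul' := fun c f => by simp [contract, LinearMap.rTensor_smul] }
  have hsurj : Function.Surjective φ := exists_contract_left_integral_eq h0 hΛ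
  -- Every contraction of `Λ` is a combination of the finitely many right legs of one expression for
  -- `Δ(Λ)`.
  have : FiniteDimensional k H := by
    classical
    refine ⟨(ℛ k Λ).index.image (ℛ k Λ).right, ?_⟩
    rw [eq_top_iff]
    rintro x -
    obtain ⟨f, rfl⟩ := hsurj x
    change contract f Λ ∈ _
    rw [(ℛ k Λ).contract_eq]
    exact Submodule.sum_mem _ fun i hi => Submodule.smul_mem _ _
      (Submodule.subset_span (Finset.mem_image_of_mem _ hi))
  have hinj : Function.Injective φ :=
    (LinearMap.injective_iff_surjective_of_finrank_eq_finrank Subspace.dual_finrank_eq).2 hsurj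
  obtain ⟨t, ht⟩ := hsurj 1
  have hφ : ∀ f : H →ₗ[k] k, φ f =
      (convScalar H f * toConv LinearMap.id : WithConv (H →ₗ[k] H)) Λ := fun f =>
    
    (convScalar_mul_apply f (toConv LinearMap.id) Λ).symm
  refine ⟨t, ?_, fun h => ?_⟩
  · rintro rfl
    have : Nontrivial H := ⟨Λ, 0, h0⟩
    exact one_ne_zero (ht.symm.trans (map_zero φ))
  · have htg : ∀ g : H →ₗ[k] k, (toConv t * toConv g).ofConv = g 1 • t := by
      intro g
      apply hinj
      rw [hφ, convScalar_mul, mul_assoc, convScalar_mul_apply]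
      change (convScalar H g * toConv LinearMap.id : WithConv (H →ₗ[k] H)) (φ t) = _
      rw [ht, map_smul, ht, convScalar_mul_apply]
      simp [contract, Algebra.TensorProduct.one_def]
    rw [← sub_eq_zero, ← Module.forall_dual_apply_eq_zero_iff k]
    intro g
    have := LinearMap.congr_fun (htg g) h
    change (toConv t * toConv g) h = _ at this
    rw [(ℛ k h).convMul_apply] at this
    rw [map_sub, (ℛ k h).contract_eq, map_sum, sub_eq_zero]
    simpa [mul_comm] using this

/-- An integral functional is nondegenerate. -/
theorem eq_zero_of_integral_functional {t : H →ₗ[k] k} (h0 : t ≠ 0)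
    (ht : ∀ h, contract t h = t h • 1) {x : H} (hx : ∀ b, t (x * b) = 0) : x = 0 := by
  let b := Module.Basis.ofVectorSpace k H
  -- The left legs of `x` inherit its vanishing property. The integral property at `xc` gives `∑
  -- t(x₁c₁) x₂c₂ = t(xc) 1 = 0`; convolving in `c` with the antipode removes `c₂`, leaving `∑
  -- t(x₁c) x₂ = 0` with independent `x₂`.
  have key : ∀ x : H, (∀ b, t (x * b) = 0) → ∀ R : Repr k x _, R.right = b →
      ∀ i ∈ R.index, ∀ c, t (R.left i * c) = 0 := by
    intro x hx R hR i hi c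
    have e1 : convScalar H (t ∘ₗ mulLeft k x) =
        ∑ i ∈ R.index, convScalar H (t ∘ₗ mulLeft k (R.left i)) *
          toConv (mulLeft k (R.right i)) := by
      ext c
      have := ht (x * c)
      rw [(R.mul (ℛ k c)).contract_eq] at this
      simpa [(ℛ k c).convMul_apply, Finset.sum_product, Algebra.smul_def] using this.symm
    have e2 : ∀ y : H, toConv (mulLeft k y) * toConv (antipode k (A := H)) =
        toConv (mulLeft k y ∘ₗ (1 : WithConv (H →ₗ[k] H)).ofConv) := by
      intro y
      rw [← id_mul_antipode]
      ext c
      have := HopfAlgebra.sum_mul_antipode_eq_algebraMap_counit (ℛ k c)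
      simp [(ℛ k c).convMul_apply, mul_assoc, ← Finset.mul_sum, this]
    have e3 := congrArg (fun f : WithConv (H →ₗ[k] H) => (f * toConv (antipode k (A := H))) c) e1
    have e4 : convScalar H (t ∘ₗ mulLeft k x) = 0 := by
      ext c
      simp [hx]
    simp only [e4, zero_mul, Finset.sum_mul, mul_assoc, e2] at e3
    simp only [WithConv.ofConv_sum, LinearMap.sum_apply, convScalar_mul_apply, WithConv.ofConv_zero,
      LinearMap.zero_apply, LinearMap.comp_apply, mulLeft_apply] at e3
    simp only [convOne_apply, counit_contract, LinearMap.comp_apply, mulLeft_apply,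
      ← Algebra.commutes, ← Algebra.smul_def, hR] at e3
    exact linearIndependent_iff'.1 b.linearIndependent R.index _ e3.symm i hi
  -- By `key`, `ε(x) t(c) = ∑ t(x₁ S(x₂) c) = 0`, and `t ≠ 0`. Applied to the left legs, this kills
  -- `x = ∑ ε(x₁) x₂`.
  have hε : ∀ x : H, (∀ b, t (x * b) = 0) → counit (R := k) x = 0 := by
    intro x hx
    obtain ⟨R, hR⟩ := exists_repr_right_basis b x
    by_contra hne
    apply h0
    ext c
    have := HopfAlgebra.sum_mul_antipode_eq_smul R
    have h1 := congrArg (fun y => t (y * c)) this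
    simp only [Finset.sum_mul, map_sum, mul_assoc] at h1
    rw [Finset.sum_eq_zero fun i hi => key x hx R hR i hi _] at h1
    simpa [hne] using h1.symm
  obtain ⟨R, hR⟩ := exists_repr_right_basis b x
  rw [← sum_counit_smul R]
  exact Finset.sum_eq_zero fun i hi => by rw [hε _ (key x hx R hR i hi), zero_smul]

end HopfAlgebra

end Integral

/-! ### Compatibility with bialgebra maps, and testing by functionals -/

section Convolution

open LinearMap

variable {k : Type*} [Field k]

/-- Both `f ∘ S` and `S ∘ f` are convolution inverses of `f`. -/
theorem BialgHom.map_antipode {A B : Type*} [Ring A] [HopfAlgebra k A] [Ring B] [HopfAlgebra k B]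
    (f : A →ₐc[k] B) (x : A) : f (HopfAlgebra.antipode k x) = HopfAlgebra.antipode k (f x) := by
  have h1 := algHom_comp_convMul_distrib (f : A →ₐ[k] B)
    (toConv (HopfAlgebra.antipode k (A := A))) (toConv LinearMap.id)
  have h2 := convMul_comp_coalgHom_distrib (toConv LinearMap.id)
    (toConv (HopfAlgebra.antipode k (A := B))) (f : A →ₗc[k] B)
  rw [antipode_mul_id] at h1
  rw [id_mul_antipode] at h2
  have key := left_inv_eq_right_inv (a := toConv (f : A →ₐ[k] B).toLinearMap)
    (b := toConv ((f : A →ₐ[k] B).toLinearMap ∘ₗ HopfAlgebra.antipode k))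
    (c := toConv (HopfAlgebra.antipode k ∘ₗ (f : A →ₗc[k] B).toLinearMap))
    (WithConv.ext (h1.symm.trans (by
      ext; simpa using AlgHomClass.commutes f _))) (WithConv.ext (h2.symm.trans (by ext; simp)))
  exact congrArg (fun g : WithConv (A →ₗ[k] B) => g x) key

theorem CoalgHom.map_contract {A B : Type*} [AddCommGroup A] [Module k A] [Coalgebra k A]
    [AddCommGroup B] [Module k B] [Coalgebra k B] (f : A →ₗc[k] B) (t : B →ₗ[k] k) (x : A) :
    f (contract (t ∘ₗ f.toLinearMap) x) = contract t (f x) := by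
  rw [((ℛ k x).induced f).contract_eq, (ℛ k x).contract_eq]
  simp

/-- To check that `∑ f(w₁) ⊗ w₂ = 1 ⊗ w` it suffices to contract with functionals. -/
theorem LinearMap.convMul_apply_eq_of_convScalar {A B : Type*} [AddCommGroup A] [Module k A]
    [Coalgebra k A] [Ring B] [Algebra k B] {f : WithConv (A →ₗ[k] B)} {w : A}
    (h : ∀ g : A →ₗ[k] k, (f * convScalar B g : WithConv (A →ₗ[k] B)) w = algebraMap k B (g w))
    (g : WithConv (A →ₗ[k] B)) : (f * g : WithConv (A →ₗ[k] B)) w = g w := by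
  let b := Module.Basis.ofVectorSpace k A
  obtain ⟨R, hR⟩ := exists_repr_right_basis b w
  have hw := sum_counit_smul R
  have key : ∀ i ∈ R.index, f (R.left i) = algebraMap k B (counit (R := k) (R.left i)) := by
    intro i hi
    have h1 := h (b.coord i)
    have h2 := congrArg (b.coord i) hw
    rw [mul_convScalar_apply R, hR, Finset.sum_eq_single i, ← h2, map_sum,
      Finset.sum_eq_single i] at h1
    · simpa [hR] using h1
    · intro j _ hj
      simp [hR, hj]
    · exact fun h => absurd hi h
    · intro j _ hj
      simp [hj]
    · exact fun h => absurd hi h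
  rw [R.convMul_apply]
  conv_rhs => rw [← hw, map_sum]
  refine Finset.sum_congr rfl fun i hi => ?_
  rw [key i hi, map_smul, Algebra.smul_def]

end Convolution

/-! ### Commutation of normal Hopf subalgebras -/

namespace HopfSubalgebra

open LinearMap

variable {k H : Type*} [Field k] [Ring H] [HopfAlgebra k H]

/-- The inclusion of a Hopf subalgebra. -/
def valBialgHom (K : HopfSubalgebra k H) : K.toSubalgebra →ₐc[k] H :=
  BialgHom.ofAlgHom K.val rfl K.map_val_comp_comulAlgHom

theorem coe_valBialgHom (K : HopfSubalgebra k H) (x : K.toSubalgebra) :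
    K.valBialgHom x = (x : H) := rfl

theorem counit_coe (K : HopfSubalgebra k H) (x : K.toSubalgebra) :
    counit (R := k) (x : H) = counit (R := k) x := rfl

theorem IsNormal.sum_conj_mem {K : HopfSubalgebra k H} (hK : K.IsNormal) {h : H} {ι : Type*}
    (R : Repr k h ι) {a : H} (ha : a ∈ K.toSubalgebra) :
    ∑ i ∈ R.index, R.left i * a * HopfAlgebra.antipode k (R.right i) ∈ K.toSubalgebra := by
  have := (hK h a ha).1
  rw [← R.eq] at this
  simpa using this

/-- Normal Hopf subalgebras which meet in the scalars commute elementwise. -/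
theorem IsNormal.commute {K L : HopfSubalgebra k H} (hK : K.IsNormal) (hL : L.IsNormal)
    (h : K.toSubalgebra ⊓ L.toSubalgebra = ⊥) (a : K.toSubalgebra) (b : L.toSubalgebra) :
    Commute (a : H) (b : H) := by
  let S : H →ₗ[k] H := HopfAlgebra.antipode k
  let v : K.toSubalgebra ⊗[k] L.toSubalgebra →ₗ[k] H ⊗[k] H :=
    TensorProduct.map K.val.toLinearMap L.val.toLinearMap
  let μ : WithConv (K.toSubalgebra ⊗[k] L.toSubalgebra →ₗ[k] H) := toConv (mul' k H ∘ₗ v)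
  let μ' : WithConv (K.toSubalgebra ⊗[k] L.toSubalgebra →ₗ[k] H) :=
    toConv (mul' k H ∘ₗ (TensorProduct.comm k H H).toLinearMap ∘ₗ v)
  let ν : WithConv (K.toSubalgebra ⊗[k] L.toSubalgebra →ₗ[k] H) :=
    toConv (mul' k H ∘ₗ TensorProduct.map S S ∘ₗ v)
  -- The value at `a ⊗ b` is `∑ a₁ b₁ S(a₂) S(b₂)`. Grouped as `a₁ (b₁ S(a₂) S(b₂))` it lies in `K`,
  -- as `(a₁ b₁ S(a₂)) S(b₂)` in `L`.
  have h1 : μ * ν = 1 := by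
    apply WithConv.ext
    refine TensorProduct.ext' fun a b => ?_
    have e : (μ * ν : WithConv (K.toSubalgebra ⊗[k] L.toSubalgebra →ₗ[k] H)) (a ⊗ₜ b) =
        ∑ i ∈ (ℛ k a).index, ∑ j ∈ (ℛ k b).index,
          (((ℛ k a).left i : H) * ((ℛ k b).left j : H)) *
            (S ((ℛ k a).right i : H) * S ((ℛ k b).right j : H)) := by
      rw [((ℛ k a).tmul (ℛ k b)).convMul_apply]
      simp [μ, ν, v, Finset.sum_product]
    have hmemK : (μ * ν : WithConv (K.toSubalgebra ⊗[k] L.toSubalgebra →ₗ[k] H)) (a ⊗ₜ b) ∈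
        K.toSubalgebra := by
      rw [e]
      refine sum_mem fun i _ => ?_
      have := K.toSubalgebra.mul_mem ((ℛ k a).left i).2
        (hK.sum_conj_mem ((ℛ k b).induced L.valBialgHom)
          (K.antipode_mem' _ ((ℛ k a).right i).2))
      simpa [Finset.mul_sum, mul_assoc, coe_valBialgHom] using this
    have hmemL : (μ * ν : WithConv (K.toSubalgebra ⊗[k] L.toSubalgebra →ₗ[k] H)) (a ⊗ₜ b) ∈
        L.toSubalgebra := by
      rw [e, Finset.sum_comm]
      refine sum_mem fun j _ => ?_
      have := L.toSubalgebra.mul_mem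
        (hL.sum_conj_mem ((ℛ k a).induced K.valBialgHom) ((ℛ k b).left j).2)
        (L.antipode_mem' _ ((ℛ k b).right j).2)
      simpa [Finset.sum_mul, mul_assoc, coe_valBialgHom] using this
    obtain ⟨c, hc⟩ := Algebra.mem_bot.1 (h.le (Algebra.mem_inf.2 ⟨hmemK, hmemL⟩))
    refine hc.symm.trans (congrArg (algebraMap k H) ?_)
    have hcε := congrArg (counit (R := k)) (hc.trans e)
    have ha := congrArg (counit (R := k)) (sum_counit_smul (ℛ k a))
    have hb := congrArg (counit (R := k)) (sum_counit_smul (ℛ k b))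
    rw [Bialgebra.counit_algebraMap] at hcε
    rw [hcε, TensorProduct.counit_tmul, ← ha, ← hb]
    simp only [map_sum, map_smul, Bialgebra.counit_mul, HopfAlgebra.counit_antipode, counit_coe,
      Finset.sum_mul_sum, smul_eq_mul, S]
    rw [Finset.sum_comm]
    exact Finset.sum_congr rfl fun i _ => Finset.sum_congr rfl fun j _ => by ring
  have h2 : ν * μ' = 1 := by
    apply WithConv.ext
    refine TensorProduct.ext' fun a b => ?_
    refine (((ℛ k a).tmul (ℛ k b)).convMul_apply _ _).trans ?_
    have ha := HopfAlgebra.sum_antipode_mul_eq_algebraMap_counit ((ℛ k a).induced K.valBialgHom)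
    have hb := HopfAlgebra.sum_antipode_mul_eq_algebraMap_counit ((ℛ k b).induced L.valBialgHom)
    simp only [Repr.induced_index, Repr.induced_left, Repr.induced_right, Function.comp_apply,
      coe_valBialgHom, counit_coe] at ha hb
    have : ∀ i ∈ (ℛ k a).index, ∑ j ∈ (ℛ k b).index,
        S ((ℛ k a).left i : H) * S ((ℛ k b).left j : H) *
          (((ℛ k b).right j : H) * ((ℛ k a).right i : H)) =
        algebraMap k H (counit (R := k) b) * (S ((ℛ k a).left i : H) * ((ℛ k a).right i : H)) := by
      intro i _
      rw [← mul_assoc, Algebra.commutes, ← hb, Finset.mul_sum, Finset.sum_mul]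
      exact Finset.sum_congr rfl fun j _ => by simp only [S, mul_assoc]
    simp only [Repr.tmul_index, Repr.tmul_left, Repr.tmul_right, Finset.sum_product]
    refine (Finset.sum_congr rfl this).trans ?_
    rw [← Finset.mul_sum, ha, ← map_mul]
    simp
  -- `ab` and `ba` are a left and a right convolution inverse of `S(a)S(b)`, so they agree.
  have h3 := left_inv_eq_right_inv (a := ν) h1 h2
  exact congrArg (fun f : WithConv (K.toSubalgebra ⊗[k] L.toSubalgebra →ₗ[k] H) => f (a ⊗ₜ b)) h3

end HopfSubalgebra

/-! ### Projections of the tensor product onto subfamilies of factors -/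

namespace PiTensorProduct

section Projection

variable {k ι : Type*} [Field k] {A : ι → Type*} [∀ i, Ring (A i)] [∀ i, HopfAlgebra k (A i)]
  [Fintype ι]

open scoped Classical in
/-- The algebra endomorphism of `⨂ A i` which is the identity on `A i` for `i ∈ T` and the counit
on the other factors. -/
def projection (T : Finset ι) : (⨂[k] i, A i) →ₐ[k] (⨂[k] i, A i) :=
  liftCommute (fun i => if i ∈ T then singleAlgHom i else
      (Algebra.ofId k _).comp (Bialgebra.counitAlgHom k (A i)))
    (fun i j hij x y => by
      have h : ∀ (c : k) (z : ⨂[k] i, A i), Commute (algebraMap k _ c) z :=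
        Algebra.commute_algebraMap_left
      split_ifs
      · exact commute_single i j hij x y
      · exact (h _ _).symm
      · exact h _ _
      · exact h _ _)

open scoped Classical in
theorem projection_single_of_mem {T : Finset ι} {i : ι} (h : i ∈ T) (a : A i) :
    projection T (singleAlgHom (R := k) i a) = singleAlgHom i a := by
  unfold projection
  rw [liftCommute_single, if_pos h]

open scoped Classical in
theorem projection_single_of_notMem {T : Finset ι} {i : ι} (h : i ∉ T) (a : A i) :
    projection T (singleAlgHom (R := k) i a) = algebraMap k _ (counit (R := k) a) := by
  unfold projection
  rw [liftCommute_single, if_neg h]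
  rfl

open scoped Classical in
theorem counit_single (i : ι) (a : A i) :
    counit (R := k) (singleAlgHom (R := k) (A := A) i a) = counit (R := k) a := by
  exact counitAlgHom_single (k := k) i a

open scoped Classical in
theorem comul_single (i : ι) (a : A i) :
    comul (R := k) (singleAlgHom (R := k) (A := A) i a) =
      Algebra.TensorProduct.map (singleAlgHom i) (singleAlgHom i) (comul (R := k) a) := by
  exact comulAlgHom_single (k := k) i a

open scoped Classical in
theorem projection_univ : projection Finset.univ = AlgHom.id k (⨂[k] i, A i) :=
  algHom_ext fun i => AlgHom.ext fun a => projection_single_of_mem (Finset.mem_univ i) a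

open scoped Classical in
theorem projection_empty : projection ∅ =
    (Algebra.ofId k _).comp (Bialgebra.counitAlgHom k (⨂[k] i, A i)) := by
  refine algHom_ext fun i => AlgHom.ext fun a => ?_
  exact (projection_single_of_notMem (Finset.notMem_empty i) a).trans
    (congrArg (algebraMap k (⨂[k] i, A i)) (counit_single i a).symm)

open scoped Classical in
theorem counit_projection (T : Finset ι) (x : ⨂[k] i, A i) :
    counit (R := k) (projection T x) = counit (R := k) x := by
  suffices h : (Bialgebra.counitAlgHom k (⨂[k] i, A i)).comp (projection T) =
      Bialgebra.counitAlgHom k (⨂[k] i, A i) from DFunLike.congr_fun h x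
  refine algHom_ext fun i => AlgHom.ext fun a => ?_
  change counit (R := k) (projection T (singleAlgHom (R := k) i a)) =
    counit (R := k) (singleAlgHom (R := k) i a)
  by_cases hi : i ∈ T
  · rw [projection_single_of_mem hi]
  · rw [projection_single_of_notMem hi, Bialgebra.counit_algebraMap, counit_single]

open scoped Classical in
/-- Algebra maps out of `⨂ A i` have commuting images if they do so on the factors. -/
theorem commute_of_commute_single {B : Type*} [Ring B] [Algebra k B] {f g : (⨂[k] i, A i) →ₐ[k] B}
    (h : ∀ i j a b, Commute (f (singleAlgHom i a)) (g (singleAlgHom j b))) (x y : ⨂[k] i, A i) :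
    Commute (f x) (g y) := by
  induction x using single_induction with
  | h1 => rw [map_one]; exact Commute.one_left _
  | hadd x y hx hy => rw [map_add]; exact hx.add_left hy
  | hmul x y hx hy => rw [map_mul]; exact hx.mul_left hy
  | hsmul c x hx => rw [map_smul]; exact hx.smul_left c
  | hs i a =>
    induction y using single_induction with
    | h1 => rw [map_one]; exact Commute.one_right _
    | hadd x y hx hy => rw [map_add]; exact hx.add_right hy
    | hmul x y hx hy => rw [map_mul]; exact hx.mul_right hy
    | hsmul c x hx => rw [map_smul]; exact hx.smul_right c
    | hs j b => exact h i j a b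

open scoped Classical in
theorem commute_projection {T U : Finset ι} (h : Disjoint T U) (x y : ⨂[k] i, A i) :
    Commute (projection T x) (projection U y) := by
  refine commute_of_commute_single (fun i j a b => ?_) x y
  by_cases hi : i ∈ T
  · by_cases hj : j ∈ U
    · rw [projection_single_of_mem hi, projection_single_of_mem hj]
      exact commute_single i j (fun hij => Finset.disjoint_left.1 h hi (hij ▸ hj)) a b
    · rw [projection_single_of_notMem hj]
      exact Algebra.commute_algebraMap_right _ _
  · rw [projection_single_of_notMem hi]
    exact Algebra.commute_algebraMap_left _ _

-- As the images commute, the convolution product is an algebra map, so it suffices to compare on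
-- single factors, where at least one projection is the counit. This splits the identity, and later
-- the multiplication map, into convolution factors.
open scoped Classical in
theorem projection_convMul_projection {T U : Finset ι} (h : Disjoint T U) :
    toConv (projection T : (⨂[k] i, A i) →ₐ[k] _).toLinearMap *
      toConv (projection U : (⨂[k] i, A i) →ₐ[k] _).toLinearMap =
      toConv (projection (T ∪ U) : (⨂[k] i, A i) →ₐ[k] _).toLinearMap := by
  have key : (Algebra.TensorProduct.lift (projection T) (projection U)
      (commute_projection h)).comp (Bialgebra.comulAlgHom k (⨂[k] i, A i)) =
      projection (T ∪ U) := by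
    refine algHom_ext fun i => AlgHom.ext fun a => ?_
    change Algebra.TensorProduct.lift (projection T) (projection U) (commute_projection h)
      (comul (R := k) (singleAlgHom (R := k) i a)) =
      projection (T ∪ U) (singleAlgHom (R := k) i a)
    rw [comul_single, ← (ℛ k a).eq]
    simp only [map_sum, Algebra.TensorProduct.map_tmul, Algebra.TensorProduct.lift_tmul]
    by_cases hT : i ∈ T
    · rw [projection_single_of_mem (Finset.mem_union_left _ hT)]
      conv_rhs => rw [← (ℛ k a).sum_smul_counit]
      simp only [projection_single_of_mem hT,
        projection_single_of_notMem (Finset.disjoint_left.1 h hT), map_sum, map_smul]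
      exact Finset.sum_congr rfl fun j _ => by rw [← Algebra.commutes, Algebra.smul_def]
    · by_cases hU : i ∈ U
      · rw [projection_single_of_mem (Finset.mem_union_right _ hU)]
        conv_rhs => rw [← sum_counit_smul (ℛ k a)]
        simp only [projection_single_of_mem hU, projection_single_of_notMem hT, map_sum, map_smul]
        exact Finset.sum_congr rfl fun j _ => (Algebra.smul_def _ _).symm
      · have hTU : i ∉ T ∪ U := by simp [hT, hU]
        rw [projection_single_of_notMem hTU]
        conv_rhs => rw [← sum_counit_smul (ℛ k a)]
        simp only [projection_single_of_notMem hU, projection_single_of_notMem hT, map_sum,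
          map_smul, smul_eq_mul, map_mul]
  apply WithConv.ext
  refine LinearMap.ext fun x => ?_
  refine Eq.trans ?_ (DFunLike.congr_fun key x)
  refine ((ℛ k x).convMul_apply _ _).trans ?_
  change _ = Algebra.TensorProduct.lift (projection T) (projection U) (commute_projection h)
    (comul (R := k) x)
  rw [← (ℛ k x).eq]
  simp

end Projection

/-! ### The multiplication map, its coinvariants and its injectivity -/

section Multiplication

open LinearMap

variable {k ι H : Type*} [Field k] {A : ι → Type*} [∀ i, Ring (A i)] [∀ i, HopfAlgebra k (A i)]
  [Ring H] [HopfAlgebra k H] [Fintype ι] (v : ∀ i, A i →ₐc[k] H)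
  (hv : ∀ i j, i ≠ j → ∀ a b, Commute (v i a) (v j b))

/-- Bialgebra maps `v i : A i → H` with commuting images induce a bialgebra map `⨂ A i → H`;
this is the underlying algebra map. -/
def mulAlgHom : (⨂[k] i, A i) →ₐ[k] H :=
  liftCommute (fun i => (v i : A i →ₐ[k] H)) hv

open scoped Classical in
theorem mulAlgHom_single (i : ι) (a : A i) : mulAlgHom v hv (singleAlgHom i a) = v i a :=
  liftCommute_single _ _ i a

open scoped Classical in
/-- Bialgebra maps `v i : A i → H` with commuting images induce a bialgebra map `⨂ A i → H`. -/
def mulBialgHom : (⨂[k] i, A i) →ₐc[k] H :=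
  BialgHom.ofAlgHom (mulAlgHom v hv)
    (algHom_ext fun i => AlgHom.ext fun a => by
      change counit (R := k) (mulAlgHom v hv (singleAlgHom i a)) =
        counit (R := k) (singleAlgHom (R := k) (A := A) i a)
      rw [mulAlgHom_single, counit_single, CoalgHomClass.counit_comp_apply])
    (algHom_ext fun i => AlgHom.ext fun a => by
      change Algebra.TensorProduct.map (mulAlgHom v hv) (mulAlgHom v hv)
          (comul (R := k) (singleAlgHom (R := k) (A := A) i a)) =
        comul (R := k) (mulAlgHom v hv (singleAlgHom i a))
      rw [mulAlgHom_single, comul_single, ← ((ℛ k a).induced (v i)).eq, ← (ℛ k a).eq]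
      simp only [map_sum, Algebra.TensorProduct.map_tmul, mulAlgHom_single, Repr.induced_index,
        Repr.induced_left, Repr.induced_right, Function.comp_apply])

open scoped Classical in
theorem mulAlgHom_surjective (hgen : ⨆ i, (v i : A i →ₐ[k] H).range = ⊤) :
    Function.Surjective (mulAlgHom v hv) := by
  rw [← AlgHom.range_eq_top, eq_top_iff, ← hgen]
  refine iSup_le fun i => ?_
  rintro _ ⟨a, rfl⟩
  exact ⟨singleAlgHom i a, mulAlgHom_single v hv i a⟩

open scoped Classical in
theorem mulAlgHom_projection_mem {T : Finset ι}
    {L : Subalgebra k H} (hL : ∀ i ∈ T, ∀ a, v i a ∈ L) (x : ⨂[k] i, A i) :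
    mulAlgHom v hv (projection T x) ∈ L := by
  induction x using single_induction with
  | h1 => simp only [map_one, one_mem]
  | hadd x y hx hy => simpa only [map_add] using add_mem hx hy
  | hmul x y hx hy => simpa only [map_mul] using mul_mem hx hy
  | hsmul c x hx => simpa only [map_smul] using L.smul_mem hx c
  | hs i a =>
    by_cases hi : i ∈ T
    · rw [projection_single_of_mem hi, mulAlgHom_single]
      exact hL i hi a
    · rw [projection_single_of_notMem hi, AlgHom.commutes]
      exact L.algebraMap_mem _

open scoped Classical in
/-- The multiplication map is injective on each factor. -/
theorem projection_eq_algebraMap {i : ι} (hi : Function.Injective (v i)) {x : ⨂[k] i, A i} {c : k}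
    (hx : mulAlgHom v hv (projection {i} x) = algebraMap k H c) :
    projection {i} x = algebraMap k _ c := by
  have hmem : ∀ x, mulAlgHom v hv (projection {i} x) ∈ (v i : A i →ₐ[k] H).range :=
    mulAlgHom_projection_mem v hv fun j hj a => by
      obtain rfl := Finset.mem_singleton.1 hj
      exact ⟨a, rfl⟩
  -- `p` reads the component in `A i` off its image in `H`, so the projection onto `A i` factors
  -- through the multiplication map.
  let p : (⨂[k] i, A i) →ₐ[k] A i :=
    ((AlgEquiv.ofInjective (v i : A i →ₐ[k] H) hi).symm : _ →ₐ[k] A i).comp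
      (((mulAlgHom v hv).comp (projection {i})).codRestrict _ hmem)
  have hp : ∀ x, v i (p x) = mulAlgHom v hv (projection {i} x) := fun x =>
    congrArg Subtype.val ((AlgEquiv.ofInjective (v i : A i →ₐ[k] H) hi).apply_symm_apply
      (((mulAlgHom v hv).comp (projection {i})).codRestrict _ hmem x))
  have hs : (singleAlgHom i).comp p = projection {i} := by
    refine algHom_ext fun j => AlgHom.ext fun a => ?_
    change singleAlgHom i (p (singleAlgHom j a)) = projection {i} (singleAlgHom j a)
    by_cases hj : j = i
    · subst hj
      rw [projection_single_of_mem (Finset.mem_singleton_self j)]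
      congr 1
      apply hi
      rw [hp, projection_single_of_mem (Finset.mem_singleton_self j), mulAlgHom_single]
    · have hj' : j ∉ ({i} : Finset ι) := by simpa using hj
      rw [projection_single_of_notMem hj']
      refine Eq.trans (congrArg _ (hi ?_)) (AlgHom.commutes _ _)
      rw [hp, projection_single_of_notMem hj', AlgHom.commutes]
      exact (AlgHomClass.commutes (v i) _).symm
  have hpx : p x = algebraMap k (A i) c := hi (by
    rw [hp, hx]
    exact (AlgHomClass.commutes (v i) _).symm)
  rw [← hs, AlgHom.comp_apply, hpx, AlgHom.commutes]

open scoped Classical in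
/-- Coinvariants of the multiplication map are scalars. -/
theorem eq_counit_smul_one_of_coinvariant (hinj : ∀ i, Function.Injective (v i))
    (hinf : ∀ i, (v i : A i →ₐ[k] H).range ⊓
      ⨆ j, ⨆ _ : j ≠ i, (v j : A j →ₐ[k] H).range = ⊥) {w : ⨂[k] i, A i}
    (hw : ∀ g : WithConv ((⨂[k] i, A i) →ₗ[k] H),
      (toConv (mulAlgHom v hv).toLinearMap * g : WithConv ((⨂[k] i, A i) →ₗ[k] H)) w = g w) :
    w = counit (R := k) w • 1 := by
  have single : ∀ i, ∀ g : WithConv ((⨂[k] i, A i) →ₗ[k] (⨂[k] i, A i)),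
      (toConv (projection {i}).toLinearMap * g :
        WithConv ((⨂[k] i, A i) →ₗ[k] (⨂[k] i, A i))) w = g w := by
    intro i
    refine convMul_apply_eq_of_convScalar fun g => ?_
    rw [mul_convScalar_apply (ℛ k w)]
    refine projection_eq_algebraMap v hv (hinj i) ?_
    let P : WithConv ((⨂[k] i, A i) →ₗ[k] H) :=
      toConv ((mulAlgHom v hv).comp (projection {i})).toLinearMap
    let q : (⨂[k] i, A i) →ₐ[k] H := (mulAlgHom v hv).comp (projection {i}ᶜ)
    let Q : WithConv ((⨂[k] i, A i) →ₗ[k] H) := toConv q.toLinearMap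
    let Q' : WithConv ((⨂[k] i, A i) →ₗ[k] H) :=
      toConv (q.toLinearMap ∘ₗ HopfAlgebra.antipode k)
    have hQ : Q * Q' = 1 := by
      have := algHom_comp_convMul_distrib q (toConv LinearMap.id)
        (toConv (HopfAlgebra.antipode k (A := ⨂[k] i, A i)))
      rw [id_mul_antipode] at this
      refine WithConv.ext (this.symm.trans ?_)
      ext x
      simp
    have hPQ : P * Q = toConv (mulAlgHom v hv).toLinearMap := by
      have := algHom_comp_convMul_distrib (mulAlgHom v hv)
        (toConv (projection {i}).toLinearMap) (toConv (projection {i}ᶜ).toLinearMap)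
      rw [projection_convMul_projection (by simp), Finset.union_compl, projection_univ] at this
      exact WithConv.ext this.symm
    -- Writing `m = P * Q`, with `P` from factor `i` and `Q` from the others, and inverting `Q` lets
    -- coinvariance cancel `m`: at `w`, `P` can be replaced by `Q'`. One lands in the range of `v
    -- i`, the other in the algebra generated by the remaining ranges.
    have hP : P = toConv (mulAlgHom v hv).toLinearMap * Q' := by
      rw [← hPQ, mul_assoc, hQ, mul_one]
    have e : (P * convScalar H g : WithConv ((⨂[k] i, A i) →ₗ[k] H)) w =
        (Q' * convScalar H g : WithConv ((⨂[k] i, A i) →ₗ[k] H)) w := by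
      rw [hP, mul_assoc, hw]
    rw [mul_convScalar_apply (ℛ k w), mul_convScalar_apply (ℛ k w)] at e
    set y := ∑ j ∈ (ℛ k w).index, g ((ℛ k w).right j) • (ℛ k w).left j with hy
    have hy1 : mulAlgHom v hv (projection {i} y) ∈ (v i : A i →ₐ[k] H).range :=
      mulAlgHom_projection_mem v hv (fun j hj a => by
        obtain rfl := Finset.mem_singleton.1 hj
        exact ⟨a, rfl⟩) y
    have hy2 : mulAlgHom v hv (projection {i} y) ∈
        ⨆ j, ⨆ _ : j ≠ i, (v j : A j →ₐ[k] H).range := by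
      refine (congrArg (· ∈ ⨆ j, ⨆ _ : j ≠ i, (v j : A j →ₐ[k] H).range) e).mpr ?_
      refine mulAlgHom_projection_mem v hv (fun j hj a => ?_) (HopfAlgebra.antipode k y)
      have hji : j ≠ i := by simpa using hj
      have hle : (v j : A j →ₐ[k] H).range ≤ ⨆ j, ⨆ _ : j ≠ i, (v j : A j →ₐ[k] H).range :=
        le_iSup₂ (f := fun j (_ : j ≠ i) => (v j : A j →ₐ[k] H).range) j hji
      exact hle ⟨a, rfl⟩
    obtain ⟨c, hc⟩ := Algebra.mem_bot.1 ((hinf i).le (Algebra.mem_inf.2 ⟨hy1, hy2⟩))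
    refine hc.symm.trans (congrArg _ ?_)
    have hcε := congrArg (counit (R := k)) hc
    rw [Bialgebra.counit_algebraMap] at hcε
    rw [hcε]
    have h1 : counit (R := k) (mulAlgHom v hv (projection {i} y)) =
        counit (R := k) (projection {i} y) :=
      CoalgHomClass.counit_comp_apply (mulBialgHom v hv) (projection {i} y)
    rw [h1, counit_projection, hy]
    conv_rhs => rw [← sum_counit_smul (ℛ k w)]
    simp [mul_comm]
  have all : ∀ T : Finset ι, ∀ g : WithConv ((⨂[k] i, A i) →ₗ[k] (⨂[k] i, A i)),
      (toConv (projection T).toLinearMap * g :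
        WithConv ((⨂[k] i, A i) →ₗ[k] (⨂[k] i, A i))) w = g w := by
    intro T
    induction T using Finset.induction_on with
    | empty =>
      intro g
      have : toConv (projection (k := k) (A := A) ∅).toLinearMap = 1 := by
        rw [projection_empty]
        rfl
      rw [this, one_mul]
    | insert i T hi ih =>
      intro g
      rw [Finset.insert_eq, ← projection_convMul_projection (by simpa using hi), mul_assoc,
        single, ih]
  -- With all factors the projection is the identity, so convolving with the unit gives `w` on the
  -- left and `ε(w) 1` on the right.
  have h := all Finset.univ 1
  rw [mul_one, projection_univ] at h
  refine Eq.trans h ?_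
  rw [convOne_apply, Algebra.algebraMap_eq_smul_one]

/-- The multiplication map is injective if `H` has a nonzero integral functional. -/
theorem mulAlgHom_injective (hgen : ⨆ i, (v i : A i →ₐ[k] H).range = ⊤)
    (hinj : ∀ i, Function.Injective (v i))
    (hinf : ∀ i, (v i : A i →ₐ[k] H).range ⊓
      ⨆ j, ⨆ _ : j ≠ i, (v j : A j →ₐ[k] H).range = ⊥)
    {t : H →ₗ[k] k} (h0 : t ≠ 0) (ht : ∀ h, contract t h = t h • 1) :
    Function.Injective (mulAlgHom v hv) := by
  let l : (⨂[k] i, A i) →ₗ[k] k := t ∘ₗ (mulAlgHom v hv).toLinearMap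
  have hl : ∀ z, mulAlgHom v hv (contract l z) = l z • 1 := fun z =>
    (CoalgHom.map_contract (mulBialgHom v hv : (⨂[k] i, A i) →ₗc[k] H) t z).trans (ht _)
  have hl' : convScalar H l * toConv (mulAlgHom v hv).toLinearMap = convScalar H l := by
    apply WithConv.ext
    refine LinearMap.ext fun z => ?_
    refine (convScalar_mul_apply l _ z).trans ((hl z).trans ?_)
    exact (Algebra.algebraMap_eq_smul_one _).symm
  -- Contractions by `l` are coinvariant: with `m` the multiplication map, `l * m = l` implies `l *
  -- (m * g) = l * g`. The resulting scalar is found by `counit_contract`.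
  have hint : ∀ z, contract l z = l z • 1 := by
    intro z
    have := eq_counit_smul_one_of_coinvariant v hv hinj hinf (w := contract l z) fun g => by
      rw [← convScalar_mul_apply, ← mul_assoc, hl', convScalar_mul_apply]
    rwa [counit_contract] at this
  refine (injective_iff_map_eq_zero _).2 fun x hx => ?_
  refine HopfAlgebra.eq_zero_of_integral_functional (t := l) (fun hl0 => h0 ?_) hint fun b => ?_
  · ext h
    obtain ⟨z, rfl⟩ := mulAlgHom_surjective v hv hgen h
    exact LinearMap.congr_fun hl0 z
  · change t (mulAlgHom v hv (x * b)) = 0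
    rw [map_mul, hx, zero_mul, map_zero]

end Multiplication

end PiTensorProduct

/-! ### Application to an internal tensor product -/

namespace IsInternalTensorProduct

variable {k H ι : Type*} [Field k] [Ring H] [HopfAlgebra k H]
  {K : ι → HopfSubalgebra k H}

theorem commute (hK : IsInternalTensorProduct K) (i j : ι) (hij : i ≠ j)
    (a : (K i).toSubalgebra) (b : (K j).toSubalgebra) :
    Commute ((K i).valBialgHom a) ((K j).valBialgHom b) := by
  have hle : (K j).toSubalgebra ≤ ⨆ j, ⨆ _ : j ≠ i, (K j).toSubalgebra :=
    le_iSup₂ (f := fun j (_ : j ≠ i) => (K j).toSubalgebra) j hij.symm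
  exact (hK.normal i).commute (hK.normal j)
    (le_bot_iff.1 ((inf_le_inf_left _ hle).trans (hK.inf_eq i).le)) a b

end IsInternalTensorProduct

theorem HopfSubalgebra.range_valBialgHom {k H : Type*} [Field k] [Ring H] [HopfAlgebra k H]
    (K : HopfSubalgebra k H) :
    (K.valBialgHom : K.toSubalgebra →ₐ[k] H).range = K.toSubalgebra :=
  K.toSubalgebra.range_val

end

theorem proposition4p2 {k H ι : Type*} [Field k] [IsAlgClosed k] [CharZero k]
    [Ring H] [HopfAlgebra k H] [IsSemisimpleRing H] [Fintype ι]
    (K : ι → HopfSubalgebra k H) (hK : IsInternalTensorProduct K) :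
    ∃ e : H ≃ₐc[k] ⨂[k] i, (K i).toSubalgebra,
      ∀ h : H, e (HopfAlgebra.antipode k h) = HopfAlgebra.antipode k (e h) := by
  obtain ⟨Λ, h0, hΛ⟩ := HopfAlgebra.exists_left_integral (k := k) (H := H)
  obtain ⟨t, ht0, ht⟩ := HopfAlgebra.exists_integral_functional h0 hΛ
  have hgen : ⨆ i, ((K i).valBialgHom : (K i).toSubalgebra →ₐ[k] H).range = ⊤ := by
    simp only [HopfSubalgebra.range_valBialgHom, hK.generate]
  have hinf : ∀ i, ((K i).valBialgHom : (K i).toSubalgebra →ₐ[k] H).range ⊓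
      ⨆ j, ⨆ _ : j ≠ i, ((K j).valBialgHom : (K j).toSubalgebra →ₐ[k] H).range = ⊥ := by
    simp only [HopfSubalgebra.range_valBialgHom, hK.inf_eq, implies_true]
  let f := PiTensorProduct.mulBialgHom (fun i => (K i).valBialgHom) hK.commute
  have hf : Function.Bijective f :=
    ⟨PiTensorProduct.mulAlgHom_injective _ hK.commute hgen (fun i => Subtype.val_injective) hinf
      ht0 ht, PiTensorProduct.mulAlgHom_surjective _ hK.commute hgen⟩
  let e := BialgEquiv.ofBijective f hf
  refine ⟨e.symm, fun h => ?_⟩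
  apply e.injective
  refine (e.apply_symm_apply _).trans (Eq.trans ?_ (f.map_antipode (e.symm h)).symm)
  exact congrArg _ (e.apply_symm_apply h).symm
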